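/- For an integer $k\ge 1$ let $\Phi(k)=\frac1k\sum_{i,j=1}^k (e_i\otimes e_i)(e_j\otimes e_j)^\dagger$ on $\mathbb C^k\otimes\mathbb C^k$. For a bipartite space $V\otimes W$ let $F\mapsto F^\Gamma$ denote the partial transpose in the second factor. A p.p.t. operation is a completely positive trace-preserving map $\Psi$ between operators on bipartite spaces such that $A\mapsto \Psi(A^\Gamma)^\Gamma$ is also completely positive and trace-preserving. For a state $\rho$ on $V\otimes W$ and a real number $K>0$ put $$F_\Gamma(\rho;K)=\max\{\operatorname{Tr}(F\rho) : F=F^\dagger,\ 0\le F\le 1,\ -\tfrac1K\le F^\Gamma\le \tfrac1K\};$$ for integers $K$ this is the fidelity of $K$-state p.p.t. distillation, $\max_\Psi \operatorname{Tr}(\Phi(K)\Psi(\rho))$ over all p.p.t. operations $\Psi$ from operators on $V\otimes W$ to operators on $\mathbb C^K\otimes\mathbb C^K$. Let $$I_d(f)=f\,\Phi(d)+\frac{1-f}{d^2-1}\,(1-\Phi(d))$$ be the isotropic state, and regard $I_d(f)^{\otimes n}$ as a state on $(\mathbb C^d)^{\otimes n}\otimes(\mathbb C^d)^{\otimes n}$,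 where the first (second) factor collects the first (second) factors of the $n$ copies. For real polynomials in $x,y$ write $A\preceq B$ if all coefficients of $B-A$ are nonnegative. Theorem. For any real numbers $0\le f\le 1$, $K>0$ and any integers $d>1$, $n>0$, $$F_\Gamma(I_d(f)^{\otimes n};K)=\max_{B,S} B\Bigl(f,\frac{1-f}{d^2-1}\Bigr),$$ where $B(x,y)$ and $S(x,y)$ range over real homogeneous polynomials of degree $n$ (the zero polynomial included) such that $$0\preceq B(x,y)\preceq (x+(d^2-1)y)^n,$$ $$-\frac1K\Bigl(\frac{d^2+d}{2}x+\frac{d^2-d}{2}y\Bigr)^n\preceq S(x,y)\preceq \frac1K\Bigl(\frac{d^2+d}{2}x+\frac{d^2-d}{2}y\Bigr)^n,$$ $$S(x,y)=B\Bigl(\frac{(d+1)x-(d-1)y}{2},\frac{x+y}{2}\Bigr).$$ All maxima are attained; in particular, when $K$ is a positive integer, the common value is also the maximum over p.p.t. operations. -/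

import Mathlib

open scoped ComplexOrder

noncomputable section

/-- The partial transpose `M ↦ M^Γ` of an operator on `V ⊗ W` (matrices indexed by `a × b`),
transposing the second tensor factor. It is written as a linear map. -/
def partialTranspose (a b : Type*) :
    Matrix (a × b) (a × b) ℂ →ₗ[ℂ] Matrix (a × b) (a × b) ℂ where
  toFun M := Matrix.of fun p q => M (p.1, q.2) (q.1, p.2)
  map_add' _ _ := rfl
  map_smul' _ _ := rfl

/-- The maximally entangled state `Φ(K) = (1/K) ∑ᵢⱼ (eᵢ ⊗ eᵢ)(eⱼ ⊗ eⱼ)†` on `ℂ^K ⊗ ℂ^K`. -/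
def maxEntangled (K : ℕ) : Matrix (Fin K × Fin K) (Fin K × Fin K) ℂ :=
  (1 / (K : ℂ)) • ∑ i : Fin K, ∑ j : Fin K, Matrix.single (i, i) (j, j) (1 : ℂ)

/-- The isotropic state `I_d(f) = f Φ(d) + (1 - f)/(d² - 1) (1 - Φ(d))`. -/
def isotropic (d : ℕ) (f : ℝ) : Matrix (Fin d × Fin d) (Fin d × Fin d) ℂ :=
  (f : ℂ) • maxEntangled d
    + (((1 - f) / ((d : ℝ) ^ 2 - 1) : ℝ) : ℂ) • (1 - maxEntangled d)

/-- The `n`-th tensor power of an operator on `V ⊗ W`, regarded as an operator on the bipartite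
space `V^{⊗n} ⊗ W^{⊗n}`. -/
def bipartitePower {a b : Type*} (ρ : Matrix (a × b) (a × b) ℂ) (n : ℕ) :
    Matrix ((Fin n → a) × (Fin n → b)) ((Fin n → a) × (Fin n → b)) ℂ :=
  Matrix.of fun p q => ∏ i : Fin n, ρ (p.1 i, p.2 i) (q.1 i, q.2 i)

/-- Primal feasibility for `F_Γ(ρ; K)`: `F` is Hermitian, `0 ≤ F ≤ 1` and
`-1/K ≤ F^Γ ≤ 1/K`. -/
structure PrimalFeasible {a b : Type*} [Fintype a] [Fintype b] [DecidableEq a] [DecidableEq b]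
    (K : ℝ) (F : Matrix (a × b) (a × b) ℂ) : Prop where
  hermitian : F.IsHermitian
  nonneg : F.PosSemidef
  le_one : (1 - F).PosSemidef
  neg_le_transpose : (partialTranspose a b F + ((1 / K : ℝ) : ℂ) • 1).PosSemidef
  transpose_le : (((1 / K : ℝ) : ℂ) • 1 - partialTranspose a b F).PosSemidef

/-- The values `Tr(Fρ)` of the primal feasible operators `F`. -/
def primalValues {a b : Type*} [Fintype a] [Fintype b] [DecidableEq a] [DecidableEq b]
    (ρ : Matrix (a × b) (a × b) ℂ) (K : ℝ) : Set ℝ :=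
  {v | ∃ F : Matrix (a × b) (a × b) ℂ, PrimalFeasible K F ∧ v = (Matrix.trace (F * ρ)).re}

/-- `F_Γ(ρ; K)` for real `K > 0`: the optimum of `Tr(Fρ)` over primal feasible `F`. -/
def FGamma {a b : Type*} [Fintype a] [Fintype b] [DecidableEq a] [DecidableEq b]
    (ρ : Matrix (a × b) (a × b) ℂ) (K : ℝ) : ℝ :=
  sSup (primalValues ρ K)

/-- The operator `∑ᵢⱼ Eᵢⱼ ⊗ Ψ(Eᵢⱼ)` attached to a superoperator `Ψ`. -/
def choi {a b : Type*} [DecidableEq a]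
    (Ψ : Matrix a a ℂ →ₗ[ℂ] Matrix b b ℂ) : Matrix (a × b) (a × b) ℂ :=
  Matrix.of fun p q => Ψ (Matrix.single p.1 q.1 1) p.2 q.2

/-- An operation: a completely positive (positive semidefinite Choi matrix), trace-preserving
superoperator. -/
structure IsOperation {a b : Type*} [Fintype a] [Fintype b] [DecidableEq a]
    (Ψ : Matrix a a ℂ →ₗ[ℂ] Matrix b b ℂ) : Prop where
  completelyPositive : (choi Ψ).PosSemidef
  tracePreserving : ∀ A, (Ψ A).trace = A.trace

/-- A p.p.t. operation from `V ⊗ W` to `V' ⊗ W'`: an operation `Ψ` for which the partially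
transposed superoperator `Ψ^Γ : A ↦ (Ψ(A^Γ))^Γ` is also an operation. (The Choi matrix of `Ψ^Γ` is
the partial transpose of that of `Ψ` in `W ⊗ W'`.) -/
structure IsPPTOperation {a b a' b' : Type*} [Fintype a] [Fintype b] [Fintype a'] [Fintype b']
    [DecidableEq a] [DecidableEq b]
    (Ψ : Matrix (a × b) (a × b) ℂ →ₗ[ℂ] Matrix (a' × b') (a' × b') ℂ) : Prop where
  operation : IsOperation Ψ
  transposed_operation :
    IsOperation (partialTranspose a' b' ∘ₗ Ψ ∘ₗ partialTranspose a b)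

/-- The fidelities `Tr(Φ(K) Ψ(ρ))` obtained from p.p.t. operations `Ψ` to `ℂ^K ⊗ ℂ^K`; for an
integer `K > 0` the maximum of this set is the fidelity of `K`-state p.p.t. distillation. -/
def pptFidelities {a b : Type*} [Fintype a] [Fintype b] [DecidableEq a] [DecidableEq b]
    (ρ : Matrix (a × b) (a × b) ℂ) (K : ℕ) : Set ℝ :=
  {v | ∃ Ψ : Matrix (a × b) (a × b) ℂ →ₗ[ℂ] Matrix (Fin K × Fin K) (Fin K × Fin K) ℂ,
    IsPPTOperation Ψ ∧ v = (Matrix.trace (maxEntangled K * Ψ ρ)).re}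

/-- `A ⪯ B`: the polynomial `B - A` has nonnegative coefficients. -/
def CoeffLE (A B : MvPolynomial (Fin 2) ℝ) : Prop :=
  ∀ m : Fin 2 →₀ ℕ, 0 ≤ (B - A).coeff m

/-- The constraints of the linear program in `B(x, y)` and `S(x, y)`, with `x = X 0`, `y = X 1`. -/
structure LPFeasible (d n : ℕ) (K : ℝ) (B S : MvPolynomial (Fin 2) ℝ) : Prop where
  homogeneous_B : B.IsHomogeneous n
  homogeneous_S : S.IsHomogeneous n
  nonneg_B : CoeffLE 0 B
  B_le : CoeffLE B
    ((MvPolynomial.X 0 + MvPolynomial.C ((d : ℝ) ^ 2 - 1) * MvPolynomial.X 1) ^ n)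
  le_S : CoeffLE
    (-(MvPolynomial.C (1 / K) *
      (MvPolynomial.C (((d : ℝ) ^ 2 + d) / 2) * MvPolynomial.X 0
        + MvPolynomial.C (((d : ℝ) ^ 2 - d) / 2) * MvPolynomial.X 1) ^ n)) S
  S_le : CoeffLE S
    (MvPolynomial.C (1 / K) *
      (MvPolynomial.C (((d : ℝ) ^ 2 + d) / 2) * MvPolynomial.X 0
        + MvPolynomial.C (((d : ℝ) ^ 2 - d) / 2) * MvPolynomial.X 1) ^ n)
  link : S = MvPolynomial.bind₁
    ![MvPolynomial.C (((d : ℝ) + 1) / 2) * MvPolynomial.X 0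
        - MvPolynomial.C (((d : ℝ) - 1) / 2) * MvPolynomial.X 1,
      MvPolynomial.C (1 / 2 : ℝ) * (MvPolynomial.X 0 + MvPolynomial.X 1)] B

/-- The values `B(f, (1 - f)/(d² - 1))` of the linear program. -/
def lpValues (d n : ℕ) (f K : ℝ) : Set ℝ :=
  {v | ∃ B S : MvPolynomial (Fin 2) ℝ, LPFeasible d n K B S ∧
    v = MvPolynomial.eval ![f, (1 - f) / ((d : ℝ) ^ 2 - 1)] B}

end

/-!
Let `Φ` be the maximally entangled state and let `Q` be the projection onto the symmetric subspace
of `ℂ^d ⊗ ℂ^d`. For a projection `P` and a subset `T` of the positions `1, …, n`, the pattern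
product `P_T` has the factor `P` in the positions of `T` and the factor `1 - P` elsewhere. For fixed `P`
these operators are orthogonal projections with sum `1`, and `(x P + y (1 - P))^{⊗n}` expands as
`∑ T, x ^ #T * y ^ (n - #T) * P_T`. Hence, for an operator `F`, the polynomial
`∑ T, Tr(F P_T) * x ^ #T * y ^ (n - #T)` gives the expectation of `F` in these powers
(`eval_subsetPoly_patternTrace`).

A feasible `F` yields the polynomial `B` with `P = Φ`, and `S` arises from the partial transpose of
`F` with `P = Q`. The constraints on `F` tested against the positive operators `Φ_T` and `Q_T` are
the coefficient constraints on `B` and `S` (`lpFeasible_patternTrace`). The link between `B` and `S`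
holds because partial transposition is self-adjoint for the trace pairing and maps
`x Q + y (1 - Q)` to a combination of `Φ` and `1 - Φ` (`partialTranspose_werner`).

Conversely, given `B`, spread its coefficients evenly over the subsets and take the combination `F`
of the `Φ_T` with `Tr(F Φ_T)` as prescribed. Its partial transpose is a combination of the `Q_T`
whose coefficients depend only on `#T`, by permutation symmetry, so the coefficient bounds on `S` bound
the spectrum of the partial transpose (`exists_primalFeasible`). Thus both problems have the same
values, and the linear program has a compact set of values (`isCompact_lpValues`).

For an integer `k`, the adjoint of a p.p.t. operation sends `Φ(k)` to a feasible operator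
(`primalFeasible_dualMap`). Conversely, measuring a feasible `F` and preparing `Φ(k)` or the
normalised `1 - Φ(k)` is a p.p.t. operation with fidelity `Tr(F ρ)` (`isPPTOperation_distillation`);
for `k = 1` the trace takes its place.
-/

noncomputable section

/-! ### Positive semidefinite matrices and traces -/

section PosSemidef

variable {m : Type*}

open scoped MatrixOrder in
theorem Matrix.PosSemidef.exists_eq_conjTranspose_mul_self [Fintype m] {A : Matrix m m ℂ}
    (hA : A.PosSemidef) : ∃ Y : Matrix m m ℂ, A = Y.conjTranspose * Y := by
  classical
  exact CStarAlgebra.nonneg_iff_eq_star_mul_self.mp hA.nonneg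

theorem Matrix.PosSemidef.trace_mul_re_nonneg [Fintype m] {A B : Matrix m m ℂ}
    (hA : A.PosSemidef) (hB : B.PosSemidef) : 0 ≤ (A * B).trace.re := by
  obtain ⟨Y, rfl⟩ := hA.exists_eq_conjTranspose_mul_self
  rw [Matrix.mul_assoc, Matrix.trace_mul_comm]
  exact (Complex.nonneg_iff.mp (hB.mul_mul_conjTranspose_same Y).trace_nonneg).1

theorem IsStarProjection.posSemidef [Fintype m] {P : Matrix m m ℂ} (hP : IsStarProjection P) :
    P.PosSemidef := by
  have h : P.conjTranspose * P = P := by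
    rw [← Matrix.star_eq_conjTranspose, hP.isSelfAdjoint.star_eq, hP.isIdempotentElem.eq]
  exact h ▸ Matrix.posSemidef_conjTranspose_mul_self P

theorem Matrix.PosSemidef.ofReal_smul {A : Matrix m m ℂ} (hA : A.PosSemidef) {c : ℝ}
    (hc : 0 ≤ c) : ((c : ℂ) • A).PosSemidef :=
  hA.smul (Complex.zero_le_real.mpr hc)

end PosSemidef

/-! ### Partial transposition -/

section PartialTranspose

variable {a b : Type*}

theorem partialTranspose_apply (M : Matrix (a × b) (a × b) ℂ) (p q : a × b) :
    partialTranspose a b M p q = M (p.1, q.2) (q.1, p.2) := rfl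

theorem partialTranspose_partialTranspose (M : Matrix (a × b) (a × b) ℂ) :
    partialTranspose a b (partialTranspose a b M) = M := rfl

theorem partialTranspose_one [DecidableEq a] [DecidableEq b] :
    partialTranspose a b 1 = 1 := by
  ext p q
  rw [partialTranspose_apply]
  simp only [Matrix.one_apply, Prod.ext_iff, eq_comm (a := q.2)]

/-- Partial transposition is self-adjoint for the trace pairing. -/
theorem trace_partialTranspose_mul [Fintype a] [Fintype b] (M N : Matrix (a × b) (a × b) ℂ) :
    (partialTranspose a b M * N).trace = (M * partialTranspose a b N).trace := by
  simp only [Matrix.trace, Matrix.diag, Matrix.mul_apply, Fintype.sum_prod_type]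
  refine Finset.sum_congr rfl fun i _ => ?_
  calc _ = ∑ k, ∑ j, ∑ l, partialTranspose a b M (i, j) (k, l) * N (k, l) (i, j) :=
        Finset.sum_comm
    _ = ∑ k, ∑ l, ∑ j, partialTranspose a b M (i, j) (k, l) * N (k, l) (i, j) :=
        Finset.sum_congr rfl fun _ _ => Finset.sum_comm
    _ = _ := Finset.sum_comm

end PartialTranspose

/-! ### Tensor products of operators on bipartite spaces -/

section BipartiteProduct

variable {a b : Type*} {n : ℕ}

/-- The tensor product of the operators `M i` on `V ⊗ W`, regarded as an operator on the bipartite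
space `V^{⊗n} ⊗ W^{⊗n}`. -/
def bipartiteProduct (M : Fin n → Matrix (a × b) (a × b) ℂ) :
    Matrix ((Fin n → a) × (Fin n → b)) ((Fin n → a) × (Fin n → b)) ℂ :=
  Matrix.of fun p q => ∏ i, M i (p.1 i, p.2 i) (q.1 i, q.2 i)

theorem bipartitePower_eq (ρ : Matrix (a × b) (a × b) ℂ) :
    bipartitePower ρ n = bipartiteProduct fun _ => ρ := rfl

theorem partialTranspose_bipartiteProduct (M : Fin n → Matrix (a × b) (a × b) ℂ) :
    partialTranspose _ _ (bipartiteProduct M) =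
      bipartiteProduct fun i => partialTranspose a b (M i) := rfl

theorem conjTranspose_bipartiteProduct (M : Fin n → Matrix (a × b) (a × b) ℂ) :
    (bipartiteProduct M).conjTranspose = bipartiteProduct fun i => (M i).conjTranspose := by
  ext p q
  simp [bipartiteProduct, Matrix.conjTranspose_apply]

theorem bipartiteProduct_smul (c : Fin n → ℂ) (M : Fin n → Matrix (a × b) (a × b) ℂ) :
    bipartiteProduct (fun i => c i • M i) = (∏ i, c i) • bipartiteProduct M := by
  ext p q
  simp [bipartiteProduct, Finset.prod_mul_distrib]

theorem prod_add_eq_sum_ite {R : Type*} [CommSemiring R] (f g : Fin n → R) :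
    ∏ i, (f i + g i) = ∑ T : Finset (Fin n), ∏ i, if i ∈ T then f i else g i := by
  rw [Finset.prod_add, Finset.powerset_univ]
  refine Finset.sum_congr rfl fun T _ => ?_
  rw [Finset.prod_ite, Finset.filter_mem_eq_inter, Finset.univ_inter]
  congr 2
  ext i
  simp

theorem prod_ite_mem_const {R : Type*} [CommMonoid R] (T : Finset (Fin n)) (x y : R) :
    (∏ i, if i ∈ T then x else y) = x ^ T.card * y ^ (n - T.card) := by
  rw [Finset.prod_ite, Finset.filter_mem_eq_inter, Finset.univ_inter, Finset.prod_const,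
    Finset.prod_const]
  have h : (Finset.univ.filter fun i => i ∉ T) = Tᶜ := by ext i; simp
  rw [h, Finset.card_compl, Fintype.card_fin]

/-- Multilinear expansion of a tensor product of sums. -/
theorem bipartiteProduct_add (M N : Fin n → Matrix (a × b) (a × b) ℂ) :
    bipartiteProduct (fun i => M i + N i) =
      ∑ T : Finset (Fin n), bipartiteProduct fun i => if i ∈ T then M i else N i := by
  ext p q
  simp only [bipartiteProduct, Matrix.of_apply, Matrix.add_apply, prod_add_eq_sum_ite,
    Matrix.sum_apply]
  refine Finset.sum_congr rfl fun T _ => Finset.prod_congr rfl fun i _ => ?_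
  split_ifs <;> rfl

theorem bipartiteProduct_one [DecidableEq a] [DecidableEq b] :
    bipartiteProduct (fun _ : Fin n => (1 : Matrix (a × b) (a × b) ℂ)) = 1 := by
  ext p q
  simp only [bipartiteProduct, Matrix.of_apply, Matrix.one_apply, Prod.ext_iff, funext_iff,
    Fintype.prod_ite_zero, Finset.prod_const_one, forall_and]

theorem bipartiteProduct_eq_zero {M : Fin n → Matrix (a × b) (a × b) ℂ} {i : Fin n}
    (h : M i = 0) : bipartiteProduct M = 0 := by
  ext p q
  exact Finset.prod_eq_zero (Finset.mem_univ i) (by rw [h]; rfl)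

variable [Fintype a] [Fintype b]

theorem sum_prod_prodMk (F : Fin n → a × b → ℂ) :
    ∑ p : (Fin n → a) × (Fin n → b), ∏ i, F i (p.1 i, p.2 i) = ∏ i, ∑ r, F i r := by
  classical
  rw [Fintype.prod_sum]
  exact Fintype.sum_equiv (Equiv.arrowProdEquivProdArrow (Fin n) (fun _ => a) fun _ => b).symm _ _
    fun _ => rfl

theorem bipartiteProduct_mul (M N : Fin n → Matrix (a × b) (a × b) ℂ) :
    bipartiteProduct M * bipartiteProduct N = bipartiteProduct fun i => M i * N i := by
  ext p q
  simp only [bipartiteProduct, Matrix.mul_apply, Matrix.of_apply, ← Finset.prod_mul_distrib]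
  exact sum_prod_prodMk fun i r => M i (p.1 i, p.2 i) r * N i r (q.1 i, q.2 i)

theorem trace_bipartiteProduct (M : Fin n → Matrix (a × b) (a × b) ℂ) :
    (bipartiteProduct M).trace = ∏ i, (M i).trace :=
  sum_prod_prodMk fun i r => M i r r

theorem posSemidef_bipartiteProduct {M : Fin n → Matrix (a × b) (a × b) ℂ}
    (hM : ∀ i, (M i).PosSemidef) : (bipartiteProduct M).PosSemidef := by
  choose Y hY using fun i => (hM i).exists_eq_conjTranspose_mul_self
  have h : bipartiteProduct M = (bipartiteProduct Y).conjTranspose * bipartiteProduct Y := by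
    rw [conjTranspose_bipartiteProduct, bipartiteProduct_mul, ← funext hY]
  exact h ▸ Matrix.posSemidef_conjTranspose_mul_self _

end BipartiteProduct

/-! ### Products of a projection and its complement -/

section PatternProduct

variable {a b : Type*} [DecidableEq a] [DecidableEq b] {n : ℕ}

/-- The tensor product with the factor `P` in the positions belonging to `T` and the factor
`1 - P` in the other positions. -/
def patternProduct (P : Matrix (a × b) (a × b) ℂ) (T : Finset (Fin n)) :
    Matrix ((Fin n → a) × (Fin n → b)) ((Fin n → a) × (Fin n → b)) ℂ :=
  bipartiteProduct fun i => if i ∈ T then P else 1 - P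

theorem bipartiteProduct_smul_add_smul (P : Matrix (a × b) (a × b) ℂ) (x y : Fin n → ℂ) :
    bipartiteProduct (fun i => x i • P + y i • (1 - P)) =
      ∑ T : Finset (Fin n), (∏ i, if i ∈ T then x i else y i) • patternProduct P T := by
  rw [bipartiteProduct_add]
  refine Finset.sum_congr rfl fun T _ => ?_
  rw [patternProduct, ← bipartiteProduct_smul]
  congr 1
  funext i
  split_ifs <;> rfl

theorem bipartitePower_smul_add_smul (P : Matrix (a × b) (a × b) ℂ) (x y : ℝ) :
    bipartitePower ((x : ℂ) • P + (y : ℂ) • (1 - P)) n =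
      ∑ T : Finset (Fin n), ((x ^ T.card * y ^ (n - T.card) : ℝ) : ℂ) • patternProduct P T := by
  rw [bipartitePower_eq, bipartiteProduct_smul_add_smul P (fun _ => (x : ℂ)) fun _ => (y : ℂ)]
  simp only [prod_ite_mem_const]
  push_cast
  rfl

theorem sum_patternProduct (P : Matrix (a × b) (a × b) ℂ) :
    ∑ T : Finset (Fin n), patternProduct P T = 1 := by
  have h := bipartiteProduct_smul_add_smul P (fun _ : Fin n => 1) fun _ => 1
  simp only [one_smul, add_sub_cancel, bipartiteProduct_one, ite_self, Finset.prod_const_one] at h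
  exact h.symm

variable [Fintype a] [Fintype b]

theorem posSemidef_patternProduct {P : Matrix (a × b) (a × b) ℂ} (hP : IsStarProjection P)
    (T : Finset (Fin n)) : (patternProduct P T).PosSemidef := by
  refine posSemidef_bipartiteProduct fun i => ?_
  split_ifs
  exacts [hP.posSemidef, hP.one_sub.posSemidef]

theorem trace_patternProduct {P : Matrix (a × b) (a × b) ℂ} {s t : ℝ} (hs : P.trace = (s : ℂ))
    (ht : (1 - P).trace = (t : ℂ)) (T : Finset (Fin n)) :
    (patternProduct P T).trace = ((s ^ T.card * t ^ (n - T.card) : ℝ) : ℂ) := by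
  rw [patternProduct, trace_bipartiteProduct]
  simp only [apply_ite Matrix.trace, hs, ht, prod_ite_mem_const]
  push_cast
  rfl

theorem patternProduct_mul_patternProduct {P : Matrix (a × b) (a × b) ℂ}
    (hP : IsIdempotentElem P) (T U : Finset (Fin n)) :
    patternProduct P T * patternProduct P U = if T = U then patternProduct P T else 0 := by
  rw [patternProduct, patternProduct, bipartiteProduct_mul]
  split_ifs with h
  · subst h
    congr 1
    funext i
    split_ifs
    exacts [hP.eq, hP.one_sub.eq]
  · obtain ⟨i, hi⟩ : ∃ i, ¬(i ∈ T ↔ i ∈ U) := by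
      by_contra! hc
      exact h (Finset.ext hc)
    refine bipartiteProduct_eq_zero (i := i) ?_
    by_cases hT : i ∈ T <;> by_cases hU : i ∈ U <;> simp_all [mul_sub, sub_mul, hP.eq]

theorem trace_sum_smul_patternProduct_mul {P : Matrix (a × b) (a × b) ℂ} (hP : IsIdempotentElem P)
    (c : Finset (Fin n) → ℝ) (U : Finset (Fin n)) :
    ((∑ T, (c T : ℂ) • patternProduct P T) * patternProduct P U).trace =
      c U * (patternProduct P U).trace := by
  simp [Finset.sum_mul, patternProduct_mul_patternProduct hP, Matrix.trace_smul]

theorem posSemidef_sum_smul_patternProduct {P : Matrix (a × b) (a × b) ℂ}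
    (hP : IsStarProjection P) {c : Finset (Fin n) → ℝ} (hc : ∀ T, 0 ≤ c T) :
    (∑ T, (c T : ℂ) • patternProduct P T).PosSemidef :=
  Matrix.posSemidef_sum _ fun T _ => (posSemidef_patternProduct hP T).ofReal_smul (hc T)

/-- Let `c T` depend only on the cardinality of `T`. Then the sum over `T` of `c T` times a product
of factors depending only on membership in `T` and in `U` is the same for equinumerous `U`, since a
permutation of the positions carries one such `U` to the other. -/
theorem sum_mul_prod_eq_of_card_eq {c : Finset (Fin n) → ℝ}
    (hc : ∀ T U : Finset (Fin n), T.card = U.card → c T = c U) (φ : Bool → Bool → ℝ)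
    {U V : Finset (Fin n)} (h : U.card = V.card) :
    ∑ T : Finset (Fin n), c T * ∏ i, φ (decide (i ∈ U)) (decide (i ∈ T)) =
      ∑ T : Finset (Fin n), c T * ∏ i, φ (decide (i ∈ V)) (decide (i ∈ T)) := by
  obtain ⟨e⟩ : Nonempty ({x // x ∈ U} ≃ {x // x ∈ V}) := by
    rw [← Fintype.card_eq]
    simpa using h
  let σ : Equiv.Perm (Fin n) := e.extendSubtype
  have hσ : ∀ i, σ i ∈ V ↔ i ∈ U := fun i => by
    by_cases hi : i ∈ U
    · simpa [hi] using e.extendSubtype_mem i hi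
    · simpa [hi] using e.extendSubtype_not_mem i hi
  refine Fintype.sum_equiv σ.finsetCongr _ _ fun T => ?_
  have hT : (σ.finsetCongr T).card = T.card := by simp
  rw [hc _ _ hT, ← Equiv.prod_comp σ fun i => φ (decide (i ∈ V)) (decide (i ∈ _))]
  congr 1
  refine Finset.prod_congr rfl fun i _ => ?_
  simp [hσ]

end PatternProduct

/-! ### Binary forms with coefficients indexed by subsets -/

section SubsetPoly

open MvPolynomial

variable {n : ℕ}

/-- The exponent of the monomial `x ^ #T * y ^ (n - #T)`. -/
def subsetExponent (T : Finset (Fin n)) : Fin 2 →₀ ℕ :=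
  Finsupp.single 0 T.card + Finsupp.single 1 (n - T.card)

theorem subsetExponent_eq_iff {T U : Finset (Fin n)} :
    subsetExponent T = subsetExponent U ↔ T.card = U.card := by
  refine ⟨fun h => ?_, fun h => by rw [subsetExponent, subsetExponent, h]⟩
  simpa [subsetExponent] using DFunLike.congr_fun h 0

theorem degree_subsetExponent (T : Finset (Fin n)) : (subsetExponent T).degree = n := by
  have h : T.card ≤ n := by simpa using T.card_le_univ
  rw [subsetExponent, map_add, Finsupp.degree_single, Finsupp.degree_single]
  omega

theorem exists_subsetExponent_eq {m : Fin 2 →₀ ℕ} (hm : m.degree = n) :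
    ∃ T : Finset (Fin n), subsetExponent T = m := by
  have h : m 0 + m 1 = n := by simpa [Finsupp.degree_eq_sum, Fin.sum_univ_two] using hm
  obtain ⟨T, -, hT⟩ := Finset.exists_subset_card_eq (s := (Finset.univ : Finset (Fin n)))
    (n := m 0) (by simp; omega)
  refine ⟨T, ?_⟩
  ext i
  fin_cases i <;> simp [subsetExponent, hT]
  omega

/-- The binary form `∑ T, g T * x ^ #T * y ^ (n - #T)` of degree `n`, the sum being over the subsets
of `Fin n`. -/
def subsetPoly (n : ℕ) : (Finset (Fin n) → ℝ) →ₗ[ℝ] MvPolynomial (Fin 2) ℝ :=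
  ∑ T, monomial (subsetExponent T) ∘ₗ LinearMap.proj T

theorem subsetPoly_apply (g : Finset (Fin n) → ℝ) :
    subsetPoly n g = ∑ T, monomial (subsetExponent T) (g T) := by
  simp [subsetPoly]

theorem coeff_subsetPoly (g : Finset (Fin n) → ℝ) (m : Fin 2 →₀ ℕ) :
    (subsetPoly n g).coeff m = ∑ T, if subsetExponent T = m then g T else 0 := by
  simp [subsetPoly_apply, coeff_sum, coeff_monomial]

theorem eval_subsetPoly (g : Finset (Fin n) → ℝ) (v : Fin 2 → ℝ) :
    eval v (subsetPoly n g) = ∑ T, g T * (v 0 ^ T.card * v 1 ^ (n - T.card)) := by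
  rw [subsetPoly_apply, map_sum]
  refine Finset.sum_congr rfl fun T _ => ?_
  rw [eval_monomial, subsetExponent, Finsupp.prod_add_index' (by simp) (by simp [pow_add])]
  simp

theorem isHomogeneous_subsetPoly (g : Finset (Fin n) → ℝ) : (subsetPoly n g).IsHomogeneous n := by
  rw [subsetPoly_apply]
  exact IsHomogeneous.sum _ _ _ fun T _ => isHomogeneous_monomial _ (degree_subsetExponent T)

theorem coeff_subsetPoly_of_card_invariant {g : Finset (Fin n) → ℝ}
    (hg : ∀ T U : Finset (Fin n), T.card = U.card → g T = g U) (U : Finset (Fin n)) :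
    (subsetPoly n g).coeff (subsetExponent U) = n.choose U.card * g U := by
  rw [coeff_subsetPoly, ← Finset.sum_filter]
  have h : (Finset.univ.filter fun T : Finset (Fin n) => subsetExponent T = subsetExponent U) =
      Finset.univ.powersetCard U.card := by
    ext T
    simp [subsetExponent_eq_iff, Finset.mem_powersetCard]
  rw [h, Finset.sum_congr rfl fun T hT => hg T U (Finset.mem_powersetCard.mp hT).2]
  simp

/-- Every binary form of degree `n` is obtained by spreading each coefficient evenly over the
subsets of the corresponding size. -/
theorem exists_subsetPoly_eq {B : MvPolynomial (Fin 2) ℝ} (hB : B.IsHomogeneous n) :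
    ∃ g : Finset (Fin n) → ℝ, (∀ T U : Finset (Fin n), T.card = U.card → g T = g U) ∧
      subsetPoly n g = B := by
  let g : Finset (Fin n) → ℝ := fun T => B.coeff (subsetExponent T) / n.choose T.card
  have hg : ∀ T U : Finset (Fin n), T.card = U.card → g T = g U := fun T U h => by
    simp only [g, subsetExponent_eq_iff.mpr h, h]
  refine ⟨g, hg, ?_⟩
  ext m
  by_cases hm : m.degree = n
  · obtain ⟨U, rfl⟩ := exists_subsetExponent_eq hm
    have hU : (n.choose U.card : ℝ) ≠ 0 := by
      have h : U.card ≤ n := by simpa using U.card_le_univ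
      exact_mod_cast (Nat.choose_pos h).ne'
    rw [coeff_subsetPoly_of_card_invariant hg, mul_div_cancel₀ _ hU]
  · rw [hB.coeff_eq_zero hm, (isHomogeneous_subsetPoly g).coeff_eq_zero hm]

theorem coeffLE_subsetPoly {g h : Finset (Fin n) → ℝ} (hgh : ∀ T, g T ≤ h T) :
    CoeffLE (subsetPoly n g) (subsetPoly n h) := fun m => by
  rw [← map_sub, coeff_subsetPoly]
  refine Finset.sum_nonneg fun T _ => ?_
  split_ifs
  exacts [sub_nonneg.mpr (hgh T), le_rfl]

/-- Comparison of coefficients gives back the comparison of the functions on subsets, provided that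
these depend on the cardinality only. -/
theorem le_of_coeffLE_subsetPoly {g h : Finset (Fin n) → ℝ}
    (hg : ∀ T U : Finset (Fin n), T.card = U.card → g T = g U)
    (hh : ∀ T U : Finset (Fin n), T.card = U.card → h T = h U)
    (hgh : CoeffLE (subsetPoly n g) (subsetPoly n h)) (T : Finset (Fin n)) : g T ≤ h T := by
  have hT := hgh (subsetExponent T)
  rw [← map_sub, coeff_subsetPoly_of_card_invariant
    fun T U h => by simp only [Pi.sub_apply, hg T U h, hh T U h]] at hT
  have h : T.card ≤ n := by simpa using T.card_le_univ
  exact sub_nonneg.mp (nonneg_of_mul_nonneg_right hT (Nat.cast_pos.mpr (Nat.choose_pos h)))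

theorem subsetPoly_pow_mul_pow (s t : ℝ) :
    subsetPoly n (fun T => s ^ T.card * t ^ (n - T.card)) = (C s * X 0 + C t * X 1) ^ n := by
  refine MvPolynomial.funext fun v => ?_
  have h := prod_add_eq_sum_ite (fun _ : Fin n => s * v 0) fun _ => t * v 1
  simp only [prod_ite_mem_const, Finset.prod_const, Finset.card_univ, Fintype.card_fin] at h
  rw [eval_subsetPoly]
  simp only [map_pow, map_add, map_mul, eval_C, eval_X, h]
  exact Finset.sum_congr rfl fun T _ => by ring

end SubsetPoly

/-! ### The linear program -/

section LinearProgram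

open MvPolynomial

variable (d n : ℕ)

/-- The substitution `B(x, y) ↦ B(((d + 1) x - (d - 1) y) / 2, (x + y) / 2)`. -/
def linkMap : MvPolynomial (Fin 2) ℝ →ₐ[ℝ] MvPolynomial (Fin 2) ℝ :=
  bind₁ ![C (((d : ℝ) + 1) / 2) * X 0 - C (((d : ℝ) - 1) / 2) * X 1, C (1 / 2 : ℝ) * (X 0 + X 1)]

theorem eval_linkMap (v : Fin 2 → ℝ) (B : MvPolynomial (Fin 2) ℝ) :
    eval v (linkMap d B) =
      eval ![((d : ℝ) + 1) / 2 * v 0 - ((d : ℝ) - 1) / 2 * v 1, 1 / 2 * (v 0 + v 1)] B := by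
  rw [linkMap, eval, eval₂Hom_bind₁]
  congr 2
  funext i
  fin_cases i <;> simp

theorem isHomogeneous_linkMap {B : MvPolynomial (Fin 2) ℝ} (hB : B.IsHomogeneous n) :
    (linkMap d B).IsHomogeneous n := by
  have h := hB.aeval (n := 1)
    ![C (((d : ℝ) + 1) / 2) * X 0 - C (((d : ℝ) - 1) / 2) * (X 1 : MvPolynomial (Fin 2) ℝ),
      C (1 / 2 : ℝ) * (X 0 + X 1)] fun i => by
    fin_cases i
    · exact (isHomogeneous_C_mul_X _ _).sub (isHomogeneous_C_mul_X _ _)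
    · exact ((isHomogeneous_X ℝ (0 : Fin 2)).add (isHomogeneous_X ℝ 1)).C_mul (1 / 2 : ℝ)
  rwa [one_mul] at h

/-- The trace of the product with pattern `T` of the projections onto the multiples of the maximally
entangled vector and its complement. -/
def isotropicWeight (T : Finset (Fin n)) : ℝ := 1 ^ T.card * ((d : ℝ) ^ 2 - 1) ^ (n - T.card)

/-- The trace of the product with pattern `T` of the projections onto the symmetric and the
antisymmetric subspace. -/
def wernerWeight (T : Finset (Fin n)) : ℝ :=
  (((d : ℝ) ^ 2 + d) / 2) ^ T.card * (((d : ℝ) ^ 2 - d) / 2) ^ (n - T.card)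

variable {d n}

/-- The constraints of the linear program with the bounding forms written over subsets and the
redundant homogeneity of `S` dropped. -/
theorem lpFeasible_iff {K : ℝ} {B S : MvPolynomial (Fin 2) ℝ} :
    LPFeasible d n K B S ↔ B.IsHomogeneous n ∧ S = linkMap d B ∧
      CoeffLE (subsetPoly n 0) B ∧ CoeffLE B (subsetPoly n (isotropicWeight d n)) ∧
      CoeffLE (subsetPoly n (-((1 / K) • wernerWeight d n))) S ∧
      CoeffLE S (subsetPoly n ((1 / K) • wernerWeight d n)) := by
  have h1 : subsetPoly n (isotropicWeight d n) = (X 0 + C ((d : ℝ) ^ 2 - 1) * X 1) ^ n := by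
    have h := subsetPoly_pow_mul_pow (n := n) 1 ((d : ℝ) ^ 2 - 1)
    rwa [C_1, one_mul] at h
  have h2 : subsetPoly n ((1 / K) • wernerWeight d n) = C (1 / K) *
      (C (((d : ℝ) ^ 2 + d) / 2) * X 0 + C (((d : ℝ) ^ 2 - d) / 2) * X 1) ^ n := by
    rw [map_smul, smul_eq_C_mul, ← subsetPoly_pow_mul_pow]
    rfl
  rw [map_neg, map_zero, h1, h2]
  constructor
  · rintro ⟨hB, -, h0, h1, h2, h3, hS⟩
    exact ⟨hB, hS, h0, h1, h2, h3⟩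
  · rintro ⟨hB, hS, h0, h1, h2, h3⟩
    exact ⟨hB, hS ▸ isHomogeneous_linkMap d n hB, h0, h1, h2, h3, hS⟩

/-- The feasible region of the linear program, parametrised by coefficients on subsets, is closed in
a box, so the set of values is compact. -/
theorem isCompact_lpValues (f K : ℝ) : IsCompact (lpValues d n f K) := by
  have hclosed : ∀ (L : (Finset (Fin n) → ℝ) →ₗ[ℝ] MvPolynomial (Fin 2) ℝ)
      (A : MvPolynomial (Fin 2) ℝ),
      IsClosed {g | CoeffLE A (L g)} ∧ IsClosed {g | CoeffLE (L g) A} := by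
    intro L A
    have hL : ∀ m, Continuous fun g => (L g).coeff m := fun m =>
      (lcoeff ℝ m ∘ₗ L).continuous_of_finiteDimensional
    simp only [CoeffLE, coeff_sub, Set.ofPred_forall]
    exact ⟨isClosed_iInter fun m => isClosed_le continuous_const ((hL m).sub continuous_const),
      isClosed_iInter fun m => isClosed_le continuous_const (continuous_const.sub (hL m))⟩
  let s : Set (Finset (Fin n) → ℝ) := Set.Icc 0 (isotropicWeight d n) ∩
    ({g | CoeffLE (subsetPoly n (-((1 / K) • wernerWeight d n)))
        (((linkMap d).toLinearMap ∘ₗ subsetPoly n) g)} ∩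
      {g | CoeffLE (((linkMap d).toLinearMap ∘ₗ subsetPoly n) g)
        (subsetPoly n ((1 / K) • wernerWeight d n))})
  have hs : IsCompact s := isCompact_Icc.inter_right ((hclosed _ _).1.inter (hclosed _ _).2)
  have himage : lpValues d n f K =
      (fun g => eval ![f, (1 - f) / ((d : ℝ) ^ 2 - 1)] (subsetPoly n g)) '' s := by
    ext v
    constructor
    · rintro ⟨B, S, hBS, rfl⟩
      obtain ⟨hB, rfl, h0, h1, h2, h3⟩ := lpFeasible_iff.mp hBS
      obtain ⟨g, hg, rfl⟩ := exists_subsetPoly_eq hB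
      refine ⟨g, ⟨⟨le_of_coeffLE_subsetPoly (fun _ _ _ => rfl) hg h0,
        le_of_coeffLE_subsetPoly hg (fun T U h => ?_) h1⟩, h2, h3⟩, rfl⟩
      simp only [isotropicWeight, h]
    · rintro ⟨g, ⟨⟨h0, h1⟩, h2, h3⟩, rfl⟩
      exact ⟨_, _, lpFeasible_iff.mpr ⟨isHomogeneous_subsetPoly g, rfl, coeffLE_subsetPoly h0,
        coeffLE_subsetPoly h1, h2, h3⟩, rfl⟩
  rw [himage]
  refine hs.image ?_
  simp only [eval_subsetPoly]
  fun_prop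

end LinearProgram

/-! ### The maximally entangled state and the swap operator -/

section Swap

/-- The operator exchanging the two tensor factors of `ℂ^d ⊗ ℂ^d`. -/
def swapMatrix (d : ℕ) : Matrix (Fin d × Fin d) (Fin d × Fin d) ℂ :=
  Matrix.of fun p q => if q = p.swap then 1 else 0

/-- The projection onto the symmetric subspace of `ℂ^d ⊗ ℂ^d`. -/
def symProjection (d : ℕ) : Matrix (Fin d × Fin d) (Fin d × Fin d) ℂ :=
  (1 / 2 : ℂ) • (1 + swapMatrix d)

variable {d : ℕ}

theorem maxEntangled_apply (p q : Fin d × Fin d) :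
    maxEntangled d p q = if p.1 = p.2 ∧ q.1 = q.2 then 1 / (d : ℂ) else 0 := by
  simp only [maxEntangled, Matrix.smul_apply, Matrix.sum_apply, Matrix.single_apply, Prod.ext_iff]
  have h : ∀ i j : Fin d, (if (i = p.1 ∧ i = p.2) ∧ j = q.1 ∧ j = q.2 then (1 : ℂ) else 0) =
      if i = p.1 then if j = q.1 then if p.1 = p.2 ∧ q.1 = q.2 then 1 else 0 else 0 else 0 := by
    intro i j
    split_ifs <;> simp_all
  simp [h]

theorem trace_maxEntangled (hd : 0 < d) : (maxEntangled d).trace = ((1 : ℝ) : ℂ) := by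
  have h : (d : ℂ) ≠ 0 := by exact_mod_cast hd.ne'
  simp [Matrix.trace, maxEntangled_apply, Fintype.sum_prod_type, h]

theorem trace_one_sub_maxEntangled (hd : 0 < d) :
    (1 - maxEntangled d).trace = (((d : ℝ) ^ 2 - 1 : ℝ) : ℂ) := by
  rw [Matrix.trace_sub, trace_maxEntangled hd]
  simp [sq]

theorem isStarProjection_maxEntangled (hd : 0 < d) : IsStarProjection (maxEntangled d) where
  isIdempotentElem := by
    have h : (d : ℂ) ≠ 0 := by exact_mod_cast hd.ne'
    ext p q
    by_cases hp : p.1 = p.2 <;> by_cases hq : q.1 = q.2 <;>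
      simp [Matrix.mul_apply, maxEntangled_apply, Fintype.sum_prod_type, hp, hq, h]
  isSelfAdjoint := by
    ext p q
    simp [maxEntangled_apply, apply_ite (starRingEnd ℂ), and_comm]

theorem swapMatrix_mul_self : swapMatrix d * swapMatrix d = 1 := by
  ext p q
  have h : ∀ r : Fin d × Fin d, q = r.swap ↔ r = q.swap := fun r => by
    rw [eq_comm, Prod.swap_eq_iff_eq_swap]
  simp [swapMatrix, Matrix.mul_apply, Matrix.one_apply, h, eq_comm (a := p)]

theorem trace_swapMatrix : (swapMatrix d).trace = d := by
  have h : ∀ i j : Fin d, (i = j ∧ j = i) ↔ i = j := fun i j => by simp [eq_comm]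
  simp only [swapMatrix, Matrix.trace, Matrix.diag_apply, Matrix.of_apply, Fintype.sum_prod_type,
    Prod.ext_iff, Prod.fst_swap, Prod.snd_swap, h]
  simp

theorem isStarProjection_symProjection : IsStarProjection (symProjection d) where
  isIdempotentElem := by
    rw [IsIdempotentElem, symProjection, smul_mul_smul_comm, mul_add, add_mul, add_mul, mul_one,
      one_mul, mul_one, swapMatrix_mul_self]
    module
  isSelfAdjoint := by
    have h : star (swapMatrix d) = swapMatrix d := by
      ext p q
      simp [swapMatrix, apply_ite (starRingEnd ℂ), Prod.ext_iff,
        and_comm, eq_comm]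
    simp [IsSelfAdjoint, symProjection, h]

theorem trace_symProjection :
    (symProjection d).trace = ((((d : ℝ) ^ 2 + d) / 2 : ℝ) : ℂ) := by
  simp [symProjection, Matrix.trace_smul, trace_swapMatrix]
  ring

theorem trace_one_sub_symProjection :
    (1 - symProjection d).trace = ((((d : ℝ) ^ 2 - d) / 2 : ℝ) : ℂ) := by
  rw [Matrix.trace_sub, trace_symProjection]
  simp
  ring

theorem partialTranspose_maxEntangled :
    partialTranspose _ _ (maxEntangled d) = (1 / (d : ℂ)) • swapMatrix d := by
  ext p q
  simp only [partialTranspose_apply, maxEntangled_apply, Matrix.smul_apply, swapMatrix,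
    Matrix.of_apply, Prod.ext_iff, Prod.fst_swap, Prod.snd_swap, smul_eq_mul, mul_ite, mul_one,
    mul_zero]
  simp only [eq_comm, and_comm]

theorem swapMatrix_eq : swapMatrix d = (2 : ℂ) • symProjection d - 1 := by
  rw [symProjection]
  module

theorem partialTranspose_swapMatrix (hd : 0 < d) :
    partialTranspose _ _ (swapMatrix d) = (d : ℂ) • maxEntangled d := by
  have h : (d : ℂ) ≠ 0 := by exact_mod_cast hd.ne'
  have h' : swapMatrix d = (d : ℂ) • partialTranspose _ _ (maxEntangled d) := by
    rw [partialTranspose_maxEntangled, smul_smul, mul_one_div_cancel h, one_smul]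
  rw [h', map_smul, partialTranspose_partialTranspose]

/-- Partial transposition carries Werner operators to isotropic operators; this is the origin of the
substitution linking the two polynomials of the linear program. -/
theorem partialTranspose_werner (hd : 0 < d) (x y : ℝ) :
    partialTranspose _ _ ((x : ℂ) • symProjection d + (y : ℂ) • (1 - symProjection d)) =
      ((((d : ℝ) + 1) / 2 * x - ((d : ℝ) - 1) / 2 * y : ℝ) : ℂ) • maxEntangled d +
        ((1 / 2 * (x + y) : ℝ) : ℂ) • (1 - maxEntangled d) := by
  simp only [symProjection, map_add, map_smul, map_sub, partialTranspose_one,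
    partialTranspose_swapMatrix hd]
  push_cast
  module

end Swap

/-! ### Expectations of operators in pattern products -/

section PatternTrace

variable {a b : Type*} [Fintype a] [Fintype b] [DecidableEq a] [DecidableEq b] {n : ℕ}

/-- The real number `Tr(F P_T)`, where `P_T` is the product of `P` and `1 - P` with pattern `T`. -/
def patternTrace (P : Matrix (a × b) (a × b) ℂ)
    (F : Matrix ((Fin n → a) × (Fin n → b)) ((Fin n → a) × (Fin n → b)) ℂ)
    (T : Finset (Fin n)) : ℝ :=
  (F * patternProduct P T).trace.re

/-- The traces against pattern products are the coefficients of the polynomial that gives the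
expectation in the powers of `x P + y (1 - P)`. -/
theorem eval_subsetPoly_patternTrace (P : Matrix (a × b) (a × b) ℂ)
    (F : Matrix ((Fin n → a) × (Fin n → b)) ((Fin n → a) × (Fin n → b)) ℂ) (v : Fin 2 → ℝ) :
    MvPolynomial.eval v (subsetPoly n (patternTrace P F)) =
      (F * bipartitePower ((v 0 : ℂ) • P + (v 1 : ℂ) • (1 - P)) n).trace.re := by
  rw [eval_subsetPoly, bipartitePower_smul_add_smul, Finset.mul_sum, Matrix.trace_sum,
    Complex.re_sum]
  refine Finset.sum_congr rfl fun T _ => ?_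
  rw [Matrix.mul_smul, Matrix.trace_smul, smul_eq_mul, Complex.re_ofReal_mul, mul_comm]
  rfl

theorem patternTrace_sub (P : Matrix (a × b) (a × b) ℂ)
    (F G : Matrix ((Fin n → a) × (Fin n → b)) ((Fin n → a) × (Fin n → b)) ℂ)
    (T : Finset (Fin n)) :
    patternTrace P (F - G) T = patternTrace P F T - patternTrace P G T := by
  simp [patternTrace, sub_mul]

theorem patternTrace_add (P : Matrix (a × b) (a × b) ℂ)
    (F G : Matrix ((Fin n → a) × (Fin n → b)) ((Fin n → a) × (Fin n → b)) ℂ)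
    (T : Finset (Fin n)) :
    patternTrace P (F + G) T = patternTrace P F T + patternTrace P G T := by
  simp [patternTrace, add_mul]

theorem patternTrace_smul_one {P : Matrix (a × b) (a × b) ℂ} {s t : ℝ} (hs : P.trace = (s : ℂ))
    (ht : (1 - P).trace = (t : ℂ)) (c : ℝ) (T : Finset (Fin n)) :
    patternTrace P ((c : ℂ) • 1) T = c * (s ^ T.card * t ^ (n - T.card)) := by
  rw [patternTrace, smul_mul_assoc, one_mul, Matrix.trace_smul, trace_patternProduct hs ht,
    smul_eq_mul, ← Complex.ofReal_mul, Complex.ofReal_re]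

theorem patternTrace_nonneg {P : Matrix (a × b) (a × b) ℂ} (hP : IsStarProjection P)
    {F : Matrix ((Fin n → a) × (Fin n → b)) ((Fin n → a) × (Fin n → b)) ℂ} (hF : F.PosSemidef)
    (T : Finset (Fin n)) : 0 ≤ patternTrace P F T :=
  hF.trace_mul_re_nonneg (posSemidef_patternProduct hP T)

theorem patternTrace_sum_smul {P : Matrix (a × b) (a × b) ℂ} (hP : IsIdempotentElem P) {s t : ℝ}
    (hs : P.trace = (s : ℂ)) (ht : (1 - P).trace = (t : ℂ)) (c : Finset (Fin n) → ℝ)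
    (U : Finset (Fin n)) :
    patternTrace P (∑ T, (c T : ℂ) • patternProduct P T) U =
      c U * (s ^ U.card * t ^ (n - U.card)) := by
  rw [patternTrace, trace_sum_smul_patternProduct_mul hP, trace_patternProduct hs ht,
    ← Complex.ofReal_mul, Complex.ofReal_re]

end PatternTrace

/-! ### Feasible operators and feasible polynomials -/

section Reduction

variable {d n : ℕ}

/-- The polynomial of the transposed operator with respect to the symmetric projection is the linked
polynomial: both compute the trace of the operator against powers of Werner operators. -/
theorem linkMap_subsetPoly_patternTrace (hd : 0 < d)
    (F : Matrix ((Fin n → Fin d) × (Fin n → Fin d)) ((Fin n → Fin d) × (Fin n → Fin d)) ℂ) :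
    linkMap d (subsetPoly n (patternTrace (maxEntangled d) F)) =
      subsetPoly n (patternTrace (symProjection d) (partialTranspose _ _ F)) := by
  refine MvPolynomial.funext fun v => ?_
  rw [eval_linkMap, eval_subsetPoly_patternTrace, eval_subsetPoly_patternTrace,
    trace_partialTranspose_mul, bipartitePower_eq _ (n := n), bipartitePower_eq _ (n := n),
    partialTranspose_bipartiteProduct, partialTranspose_werner hd]
  rfl

/-- The coefficient of the symmetric (`u = true`) or antisymmetric (`u = false`) projection in the
partial transpose of the maximally entangled state (`t = true`) or of its complement
(`t = false`). -/
def transposeWeight (d : ℕ) (u t : Bool) : ℝ :=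
  if u then (if t then 1 / (d : ℝ) else 1 - 1 / (d : ℝ))
  else (if t then -(1 / (d : ℝ)) else 1 + 1 / (d : ℝ))

/-- The coefficients in the products of symmetric and antisymmetric projections of the partial
transpose of a combination of pattern products of the maximally entangled state. -/
def transposedCoeff (d : ℕ) (c : Finset (Fin n) → ℝ) (U : Finset (Fin n)) : ℝ :=
  ∑ T : Finset (Fin n), c T *
    ∏ i, transposeWeight d (decide (i ∈ U)) (decide (i ∈ T))

theorem transposedCoeff_of_card_eq {c : Finset (Fin n) → ℝ}
    (hc : ∀ T U : Finset (Fin n), T.card = U.card → c T = c U) (U V : Finset (Fin n))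
    (h : U.card = V.card) : transposedCoeff d c U = transposedCoeff d c V :=
  sum_mul_prod_eq_of_card_eq hc _ h

theorem partialTranspose_sum_smul_patternProduct (c : Finset (Fin n) → ℝ) :
    partialTranspose _ _ (∑ T, (c T : ℂ) • patternProduct (maxEntangled d) T) =
      ∑ U, (transposedCoeff d c U : ℂ) • patternProduct (symProjection d) U := by
  have h : ∀ T : Finset (Fin n), partialTranspose _ _ (patternProduct (maxEntangled d) T) =
      ∑ U : Finset (Fin n), ((∏ i, transposeWeight d (decide (i ∈ U)) (decide (i ∈ T)) : ℝ) : ℂ) •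
        patternProduct (symProjection d) U := by
    intro T
    have hfactor : (fun i => partialTranspose _ _
        (if i ∈ T then maxEntangled d else 1 - maxEntangled d)) = fun i =>
        (if i ∈ T then 1 / (d : ℂ) else 1 - 1 / (d : ℂ)) • symProjection d +
          (if i ∈ T then -(1 / (d : ℂ)) else 1 + 1 / (d : ℂ)) • (1 - symProjection d) := by
      funext i
      split_ifs
      · rw [partialTranspose_maxEntangled, swapMatrix_eq]
        module
      · rw [map_sub, partialTranspose_one, partialTranspose_maxEntangled, swapMatrix_eq]
        module
    rw [patternProduct, partialTranspose_bipartiteProduct, hfactor, bipartiteProduct_smul_add_smul]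
    refine Finset.sum_congr rfl fun U _ => ?_
    congr 1
    push_cast
    refine Finset.prod_congr rfl fun i _ => ?_
    by_cases hU : i ∈ U <;> by_cases hT : i ∈ T <;> simp [transposeWeight, hU, hT]
  simp only [map_sum, map_smul, h, Finset.smul_sum, smul_smul]
  rw [Finset.sum_comm]
  refine Finset.sum_congr rfl fun U _ => ?_
  rw [← Finset.sum_smul]
  congr 1
  simp [transposedCoeff]

theorem isotropicWeight_pos (hd : 1 < d) (T : Finset (Fin n)) : 0 < isotropicWeight d n T := by
  have h : (1 : ℝ) < d := by exact_mod_cast hd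
  have h' : (0 : ℝ) < (d : ℝ) ^ 2 - 1 := by nlinarith
  unfold isotropicWeight
  positivity

theorem wernerWeight_pos (hd : 1 < d) (T : Finset (Fin n)) : 0 < wernerWeight d n T := by
  have h : (1 : ℝ) < d := by exact_mod_cast hd
  have h' : (0 : ℝ) < (d : ℝ) ^ 2 - d := by nlinarith
  unfold wernerWeight
  positivity

/-- Testing the constraints on a feasible operator against the positive pattern products gives the
constraints of the linear program. -/
theorem lpFeasible_patternTrace {K : ℝ} (hd : 0 < d)
    {F : Matrix ((Fin n → Fin d) × (Fin n → Fin d)) ((Fin n → Fin d) × (Fin n → Fin d)) ℂ}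
    (hF : PrimalFeasible K F) :
    LPFeasible d n K (subsetPoly n (patternTrace (maxEntangled d) F))
      (linkMap d (subsetPoly n (patternTrace (maxEntangled d) F))) := by
  have hΦ := isStarProjection_maxEntangled hd
  have hS := isStarProjection_symProjection (d := d)
  refine lpFeasible_iff.mpr ⟨isHomogeneous_subsetPoly _, rfl, ?_⟩
  rw [linkMap_subsetPoly_patternTrace hd]
  refine ⟨coeffLE_subsetPoly fun T => patternTrace_nonneg hΦ hF.nonneg T,
    coeffLE_subsetPoly fun T => ?_, coeffLE_subsetPoly fun T => ?_, coeffLE_subsetPoly fun T => ?_⟩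
  · have h := patternTrace_nonneg hΦ hF.le_one T
    have h1 := patternTrace_smul_one (trace_maxEntangled hd) (trace_one_sub_maxEntangled hd) 1 T
    rw [Complex.ofReal_one, one_smul, one_mul] at h1
    rw [patternTrace_sub, h1] at h
    exact sub_nonneg.mp h
  · have h := patternTrace_nonneg hS hF.neg_le_transpose T
    rw [patternTrace_add, patternTrace_smul_one trace_symProjection trace_one_sub_symProjection]
      at h
    exact neg_le_iff_add_nonneg.mpr h
  · have h := patternTrace_nonneg hS hF.transpose_le T
    rw [patternTrace_sub, patternTrace_smul_one trace_symProjection trace_one_sub_symProjection]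
      at h
    exact sub_nonneg.mp h

/-- A feasible polynomial whose coefficients are spread evenly over subsets comes from a feasible
operator, namely the combination of pattern products with the prescribed traces. -/
theorem exists_primalFeasible {K : ℝ} (hd : 1 < d) {g : Finset (Fin n) → ℝ}
    (hg : ∀ T U : Finset (Fin n), T.card = U.card → g T = g U)
    (hB : LPFeasible d n K (subsetPoly n g) (linkMap d (subsetPoly n g))) :
    ∃ F : Matrix ((Fin n → Fin d) × (Fin n → Fin d)) ((Fin n → Fin d) × (Fin n → Fin d)) ℂ,
      PrimalFeasible K F ∧ patternTrace (maxEntangled d) F = g := by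
  have hd0 : 0 < d := by omega
  have hΦ := isStarProjection_maxEntangled hd0
  have hS := isStarProjection_symProjection (d := d)
  have hw : ∀ T U : Finset (Fin n), T.card = U.card →
      isotropicWeight d n T = isotropicWeight d n U :=
    fun T U h => by simp only [isotropicWeight, h]
  have hw' : ∀ T U : Finset (Fin n), T.card = U.card → wernerWeight d n T = wernerWeight d n U :=
    fun T U h => by simp only [wernerWeight, h]
  let c : Finset (Fin n) → ℝ := fun T => g T / isotropicWeight d n T
  have hc : ∀ T U : Finset (Fin n), T.card = U.card → c T = c U := fun T U h => by
    simp only [c, hg T U h, hw T U h]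
  let F := ∑ T, (c T : ℂ) • patternProduct (maxEntangled d) T
  let e := transposedCoeff d c
  have he : ∀ T U : Finset (Fin n), T.card = U.card → e T = e U := transposedCoeff_of_card_eq hc
  have hFΓ : partialTranspose _ _ F = ∑ U, (e U : ℂ) • patternProduct (symProjection d) U :=
    partialTranspose_sum_smul_patternProduct c
  have hFg : patternTrace (maxEntangled d) F = g := funext fun T => by
    rw [patternTrace_sum_smul hΦ.isIdempotentElem (trace_maxEntangled hd0)
      (trace_one_sub_maxEntangled hd0)]
    exact div_mul_cancel₀ _ (isotropicWeight_pos hd T).ne'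
  have hFe : patternTrace (symProjection d) (partialTranspose _ _ F) = e * wernerWeight d n :=
    funext fun T => by
      rw [hFΓ, patternTrace_sum_smul hS.isIdempotentElem trace_symProjection
        trace_one_sub_symProjection]
      rfl
  obtain ⟨-, -, h0, h1, h2, h3⟩ := lpFeasible_iff.mp hB
  rw [← hFg, linkMap_subsetPoly_patternTrace hd0, hFe] at h2 h3
  have hew : ∀ T U : Finset (Fin n), T.card = U.card →
      (e * wernerWeight d n) T = (e * wernerWeight d n) U := fun T U h => by
    simp only [Pi.mul_apply, he T U h, hw' T U h]
  have g0 := le_of_coeffLE_subsetPoly (fun _ _ _ => rfl) hg h0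
  have g1 := le_of_coeffLE_subsetPoly hg hw h1
  have g2 := le_of_coeffLE_subsetPoly (fun T U h => by simp [hw' T U h]) hew h2
  have g3 := le_of_coeffLE_subsetPoly hew (fun T U h => by simp [hw' T U h]) h3
  have hF : F.PosSemidef := posSemidef_sum_smul_patternProduct hΦ fun T =>
    div_nonneg (g0 T) (isotropicWeight_pos hd T).le
  refine ⟨F, ⟨hF.isHermitian, hF, ?_, ?_, ?_⟩, hFg⟩
  · have h : 1 - F = ∑ T, ((1 - c T : ℝ) : ℂ) • patternProduct (maxEntangled d) T := by
      simp [F, sub_smul, Finset.sum_sub_distrib, sum_patternProduct]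
    rw [h]
    exact posSemidef_sum_smul_patternProduct hΦ fun T =>
      sub_nonneg.mpr ((div_le_one (isotropicWeight_pos hd T)).mpr (g1 T))
  · have h : partialTranspose _ _ F + ((1 / K : ℝ) : ℂ) • 1 =
        ∑ T, ((e T + 1 / K : ℝ) : ℂ) • patternProduct (symProjection d) T := by
      simp only [hFΓ, Complex.ofReal_add, add_smul, Finset.sum_add_distrib, ← Finset.smul_sum,
        sum_patternProduct]
    rw [h]
    refine posSemidef_sum_smul_patternProduct hS fun T => ?_
    have hT : -(1 / K) * wernerWeight d n T ≤ e T * wernerWeight d n T :=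
      (neg_mul (1 / K) (wernerWeight d n T)).trans_le (g2 T)
    linarith [le_of_mul_le_mul_right hT (wernerWeight_pos hd T)]
  · have h : ((1 / K : ℝ) : ℂ) • 1 - partialTranspose _ _ F =
        ∑ T, ((1 / K - e T : ℝ) : ℂ) • patternProduct (symProjection d) T := by
      simp only [hFΓ, Complex.ofReal_sub, sub_smul, Finset.sum_sub_distrib, ← Finset.smul_sum,
        sum_patternProduct]
    rw [h]
    exact posSemidef_sum_smul_patternProduct hS fun T =>
      sub_nonneg.mpr (le_of_mul_le_mul_right (g3 T) (wernerWeight_pos hd T))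

/-- The linear program and the optimisation over operators have the same values. -/
theorem primalValues_eq_lpValues (f K : ℝ) (hd : 1 < d) :
    primalValues (bipartitePower (isotropic d f) n) K = lpValues d n f K := by
  have hd0 : 0 < d := by omega
  have hvalue : ∀ F, (F * bipartitePower (isotropic d f) n).trace.re =
      MvPolynomial.eval ![f, (1 - f) / ((d : ℝ) ^ 2 - 1)]
        (subsetPoly n (patternTrace (maxEntangled d) F)) := fun F => by
    rw [eval_subsetPoly_patternTrace, isotropic, Matrix.cons_val_zero, Matrix.cons_val_one,
      Matrix.cons_val_fin_one]
  ext v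
  constructor
  · rintro ⟨F, hF, rfl⟩
    exact ⟨_, _, lpFeasible_patternTrace hd0 hF, hvalue F⟩
  · rintro ⟨B, S, hBS, rfl⟩
    obtain ⟨hB, rfl, -⟩ := lpFeasible_iff.mp hBS
    obtain ⟨g, hg, rfl⟩ := exists_subsetPoly_eq hB
    obtain ⟨F, hF, rfl⟩ := exists_primalFeasible hd hg hBS
    exact ⟨F, hF, (hvalue F).symm⟩

end Reduction

/-! ### Adjoints of operations -/

section DualMap

variable {a b : Type*} [Fintype b] [DecidableEq a]

/-- The adjoint of a superoperator `Ψ` for the trace pairing: `Tr(Ψ†(X) A) = Tr(X Ψ(A))`. -/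
def dualMap (Ψ : Matrix a a ℂ →ₗ[ℂ] Matrix b b ℂ) : Matrix b b ℂ →ₗ[ℂ] Matrix a a ℂ where
  toFun X := Matrix.of fun j i => (X * Ψ (Matrix.single i j 1)).trace
  map_add' X Y := by
    ext
    simp [add_mul]
  map_smul' c X := by
    ext
    simp

theorem dualMap_apply (Ψ : Matrix a a ℂ →ₗ[ℂ] Matrix b b ℂ) (X : Matrix b b ℂ) (j i : a) :
    dualMap Ψ X j i = (X * Ψ (Matrix.single i j 1)).trace := rfl

variable [Fintype a]

theorem trace_dualMap_mul (Ψ : Matrix a a ℂ →ₗ[ℂ] Matrix b b ℂ) (X : Matrix b b ℂ)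
    (A : Matrix a a ℂ) : (dualMap Ψ X * A).trace = (X * Ψ A).trace := by
  have h : ∀ i j, Matrix.single i j (A i j) = A i j • Matrix.single i j (1 : ℂ) := fun i j => by
    simp
  conv_rhs => rw [Matrix.matrix_eq_sum_single A]
  simp only [h, map_sum, map_smul, Matrix.mul_sum, Matrix.trace_sum, Matrix.mul_smul,
    Matrix.trace_smul, smul_eq_mul, ← dualMap_apply]
  rw [Finset.sum_comm]
  simp only [Matrix.trace, Matrix.diag_apply, Matrix.mul_apply, mul_comm]

theorem dualMap_one [DecidableEq b] {Ψ : Matrix a a ℂ →ₗ[ℂ] Matrix b b ℂ} (hΨ : IsOperation Ψ) :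
    dualMap Ψ 1 = 1 := by
  ext j i
  rw [dualMap_apply, one_mul, hΨ.tracePreserving, Matrix.one_apply]
  split_ifs with h
  · rw [h, Matrix.trace_single_eq_same]
  · exact Matrix.trace_single_eq_of_ne _ _ _ (Ne.symm h)

/-- The adjoint of a completely positive map is positive. -/
theorem posSemidef_dualMap {Ψ : Matrix a a ℂ →ₗ[ℂ] Matrix b b ℂ} (hΨ : IsOperation Ψ)
    {X : Matrix b b ℂ} (hX : X.PosSemidef) : (dualMap Ψ X).PosSemidef := by
  obtain ⟨Y, rfl⟩ := hX.exists_eq_conjTranspose_mul_self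
  -- Each row of `Y` gives a compression of the Choi matrix.
  let W : b → Matrix a (a × b) ℂ := fun r => Matrix.of fun i p => if i = p.1 then Y r p.2 else 0
  have h : (dualMap Ψ (Y.conjTranspose * Y)).transpose =
      ∑ r, W r * choi Ψ * (W r).conjTranspose := by
    ext i j
    simp only [Matrix.transpose_apply, dualMap_apply, Matrix.sum_apply, Matrix.mul_apply,
      Matrix.trace, Matrix.diag_apply, W, choi, Matrix.of_apply, Matrix.conjTranspose_apply,
      Fintype.sum_prod_type, Finset.sum_mul, apply_ite (star : ℂ → ℂ), star_zero, ite_mul, zero_mul,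
      mul_ite, mul_zero]
    simp only [Finset.sum_ite_irrel, Finset.sum_const_zero, Finset.sum_ite_eq, Finset.mem_univ,
      if_true]
    calc _ = ∑ p, ∑ r, ∑ q, star (Y r p) * Y r q * Ψ (Matrix.single i j 1) q p :=
          Finset.sum_congr rfl fun _ _ => Finset.sum_comm
      _ = ∑ r, ∑ p, ∑ q, star (Y r p) * Y r q * Ψ (Matrix.single i j 1) q p := Finset.sum_comm
      _ = _ := Finset.sum_congr rfl fun r _ => Finset.sum_congr rfl fun p _ =>
          Finset.sum_congr rfl fun q _ => by ring
  rw [← Matrix.posSemidef_transpose_iff, h]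
  exact Matrix.posSemidef_sum _ fun r _ =>
    hΨ.completelyPositive.mul_mul_conjTranspose_same (W r)

end DualMap

/-! ### Measure-and-prepare operations -/

section MeasurePrepare

/-- The superoperator `A ↦ Tr(E A) R`. -/
def measurePrepare {a b : Type*} [Fintype a] (E : Matrix a a ℂ) (R : Matrix b b ℂ) :
    Matrix a a ℂ →ₗ[ℂ] Matrix b b ℂ where
  toFun A := (E * A).trace • R
  map_add' A B := by simp [mul_add, add_smul]
  map_smul' c A := by simp [mul_smul]

theorem measurePrepare_apply {a b : Type*} [Fintype a] (E : Matrix a a ℂ) (R : Matrix b b ℂ)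
    (A : Matrix a a ℂ) : measurePrepare E R A = (E * A).trace • R := rfl

open scoped Kronecker in
theorem choi_measurePrepare {a b : Type*} [Fintype a] [DecidableEq a] (E : Matrix a a ℂ)
    (R : Matrix b b ℂ) : choi (measurePrepare E R) = E.transpose ⊗ₖ R := by
  ext p q
  simp [choi, measurePrepare_apply, Matrix.trace_mul_single]

theorem isOperation_measurePrepare_add {a b : Type*} [Fintype a] [DecidableEq a] [Fintype b]
    {E E' : Matrix a a ℂ} {R R' : Matrix b b ℂ} (hE : E.PosSemidef) (hE' : E'.PosSemidef)
    (hR : R.PosSemidef) (hR' : R'.PosSemidef) (h : R.trace • E + R'.trace • E' = 1) :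
    IsOperation (measurePrepare E R + measurePrepare E' R') where
  completelyPositive := by
    have hadd : choi (measurePrepare E R + measurePrepare E' R') =
        choi (measurePrepare E R) + choi (measurePrepare E' R') := rfl
    rw [hadd, choi_measurePrepare, choi_measurePrepare]
    exact (hE.transpose.kronecker hR).add (hE'.transpose.kronecker hR')
  tracePreserving A := by
    have hA := congrArg (fun X => (X * A).trace) h
    simp only [add_mul, Matrix.trace_add, smul_mul_assoc, Matrix.trace_smul, one_mul,
      smul_eq_mul] at hA
    simp only [LinearMap.add_apply, measurePrepare_apply, Matrix.trace_add, Matrix.trace_smul,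
      smul_eq_mul]
    rw [← hA]
    ring

theorem partialTranspose_comp_measurePrepare_comp {a b a' b' : Type*} [Fintype a] [Fintype b]
    (E : Matrix (a × b) (a × b) ℂ) (R : Matrix (a' × b') (a' × b') ℂ) :
    partialTranspose a' b' ∘ₗ measurePrepare E R ∘ₗ partialTranspose a b =
      measurePrepare (partialTranspose a b E) (partialTranspose a' b' R) := by
  ext1 A
  simp only [LinearMap.comp_apply, measurePrepare_apply, map_smul, trace_partialTranspose_mul]

end MeasurePrepare

/-! ### Distillation by p.p.t. operations -/

section Distillation

variable {a b : Type*} [DecidableEq a] [DecidableEq b] {k : ℕ}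

/-- Passing to the adjoint commutes with partial transposition. -/
theorem partialTranspose_dualMap {a' b' : Type*} [Fintype a'] [Fintype b']
    (Ψ : Matrix (a × b) (a × b) ℂ →ₗ[ℂ] Matrix (a' × b') (a' × b') ℂ)
    (X : Matrix (a' × b') (a' × b') ℂ) :
    partialTranspose a b (dualMap Ψ X) =
      dualMap (partialTranspose a' b' ∘ₗ Ψ ∘ₗ partialTranspose a b) (partialTranspose a' b' X) := by
  ext p q
  have h : partialTranspose a b (Matrix.single q p 1) = Matrix.single (q.1, p.2) (p.1, q.2) 1 := by
    ext r s
    simp only [partialTranspose_apply, Matrix.single_apply, Prod.ext_iff]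
    congr 1
    exact propext (by tauto)
  rw [partialTranspose_apply, dualMap_apply, dualMap_apply, LinearMap.comp_apply,
    LinearMap.comp_apply, trace_partialTranspose_mul, partialTranspose_partialTranspose, h]

variable [Fintype a] [Fintype b]

theorem partialTranspose_maxEntangled_add :
    partialTranspose _ _ (maxEntangled k) + ((1 / k : ℝ) : ℂ) • 1 =
      ((2 / k : ℝ) : ℂ) • symProjection k := by
  rw [partialTranspose_maxEntangled, swapMatrix_eq]
  push_cast
  module

theorem sub_partialTranspose_maxEntangled :
    ((1 / k : ℝ) : ℂ) • 1 - partialTranspose _ _ (maxEntangled k) =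
      ((2 / k : ℝ) : ℂ) • (1 - symProjection k) := by
  rw [partialTranspose_maxEntangled, swapMatrix_eq]
  push_cast
  module

/-- The adjoint of a p.p.t. operation sends the maximally entangled state to a feasible operator. -/
theorem primalFeasible_dualMap (hk : 0 < k)
    {Ψ : Matrix (a × b) (a × b) ℂ →ₗ[ℂ] Matrix (Fin k × Fin k) (Fin k × Fin k) ℂ}
    (hΨ : IsPPTOperation Ψ) : PrimalFeasible (k : ℝ) (dualMap Ψ (maxEntangled k)) := by
  have hΦ := isStarProjection_maxEntangled hk
  have hS := isStarProjection_symProjection (d := k)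
  have hF := posSemidef_dualMap hΨ.operation hΦ.posSemidef
  refine ⟨hF.isHermitian, hF, ?_, ?_, ?_⟩
  -- Since the adjoint is unital, every constraint is the image of a positive operator.
  · rw [← dualMap_one hΨ.operation, ← map_sub]
    exact posSemidef_dualMap hΨ.operation hΦ.one_sub.posSemidef
  · rw [partialTranspose_dualMap, ← dualMap_one hΨ.transposed_operation, ← map_smul, ← map_add,
      partialTranspose_maxEntangled_add]
    exact posSemidef_dualMap hΨ.transposed_operation (hS.posSemidef.ofReal_smul (by positivity))
  · rw [partialTranspose_dualMap, ← dualMap_one hΨ.transposed_operation, ← map_smul, ← map_sub,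
      sub_partialTranspose_maxEntangled]
    exact posSemidef_dualMap hΨ.transposed_operation
      (hS.one_sub.posSemidef.ofReal_smul (by positivity))

theorem pptFidelities_subset_primalValues (hk : 0 < k) (ρ : Matrix (a × b) (a × b) ℂ) :
    pptFidelities ρ k ⊆ primalValues ρ k := by
  rintro v ⟨Ψ, hΨ, rfl⟩
  exact ⟨_, primalFeasible_dualMap hk hΨ, by rw [trace_dualMap_mul]⟩

/-- The distillation protocol attached to a feasible operator `F`: measure `F`, prepare the
maximally entangled state on success and the normalised complementary projection on failure. -/
def distillation (k : ℕ) (F : Matrix (a × b) (a × b) ℂ) :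
    Matrix (a × b) (a × b) ℂ →ₗ[ℂ] Matrix (Fin k × Fin k) (Fin k × Fin k) ℂ :=
  measurePrepare F (maxEntangled k) +
    measurePrepare (1 - F) (((1 / ((k : ℝ) ^ 2 - 1) : ℝ) : ℂ) • (1 - maxEntangled k))

/-- The partial transpose of the distillation protocol is again of measure-and-prepare form, now
with the normalised projections onto the symmetric and the antisymmetric subspace as outputs. -/
theorem partialTranspose_comp_distillation_comp (hk : 1 < k) (F : Matrix (a × b) (a × b) ℂ) :
    partialTranspose _ _ ∘ₗ distillation k F ∘ₗ partialTranspose _ _ =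
      measurePrepare (((k / 2 : ℝ) : ℂ) • (partialTranspose _ _ F + ((1 / k : ℝ) : ℂ) • 1))
          (((2 / (k ^ 2 + k) : ℝ) : ℂ) • symProjection k) +
        measurePrepare (((k / 2 : ℝ) : ℂ) • (((1 / k : ℝ) : ℂ) • 1 - partialTranspose _ _ F))
          (((2 / (k ^ 2 - k) : ℝ) : ℂ) • (1 - symProjection k)) := by
  have h1 : (1 : ℝ) < k := by exact_mod_cast hk
  have hk0 : (k : ℂ) ≠ 0 := by exact_mod_cast (by omega : k ≠ 0)
  have hk1 : (k : ℂ) - 1 ≠ 0 := by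
    rw [sub_ne_zero]
    exact_mod_cast hk.ne'
  have hk2 : (k : ℂ) + 1 ≠ 0 := by exact_mod_cast (by omega : k + 1 ≠ 0)
  have e1 : (k : ℂ) ^ 2 - 1 = (k - 1) * (k + 1) := by ring
  have e2 : (k : ℂ) ^ 2 + k = k * (k + 1) := by ring
  have e3 : (k : ℂ) ^ 2 - k = k * (k - 1) := by ring
  rw [distillation, LinearMap.add_comp, LinearMap.comp_add,
    partialTranspose_comp_measurePrepare_comp, partialTranspose_comp_measurePrepare_comp]
  ext1 A
  simp only [LinearMap.add_apply, measurePrepare_apply, map_smul, map_sub, partialTranspose_one,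
    partialTranspose_maxEntangled, swapMatrix_eq, add_mul, sub_mul, smul_mul_assoc, one_mul,
    Matrix.trace_add, Matrix.trace_sub, Matrix.trace_smul, smul_eq_mul]
  push_cast
  rw [e1, e2, e3]
  match_scalars
  · field_simp
    ring
  · field_simp
    ring

theorem isPPTOperation_distillation (hk : 1 < k) {F : Matrix (a × b) (a × b) ℂ}
    (hF : PrimalFeasible (k : ℝ) F) : IsPPTOperation (distillation k F) := by
  have h1 : (1 : ℝ) < k := by exact_mod_cast hk
  have hk0 : 0 < k := by omega
  have hsq : (0 : ℝ) < (k : ℝ) ^ 2 - 1 := by nlinarith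
  have hadd : (0 : ℝ) < (k : ℝ) ^ 2 + k := by positivity
  have hsub : (0 : ℝ) < (k : ℝ) ^ 2 - k := by nlinarith
  have hΦ := isStarProjection_maxEntangled hk0
  have hS := isStarProjection_symProjection (d := k)
  have htrace : ∀ {m : Type} [Fintype m] {P : Matrix m m ℂ} {s c : ℝ}, P.trace = (s : ℂ) →
      c * s = 1 → ((c : ℂ) • P).trace = 1 := by
    intro m _ P s c hP hc
    rw [Matrix.trace_smul, hP, smul_eq_mul, ← Complex.ofReal_mul, hc, Complex.ofReal_one]
  constructor
  · refine isOperation_measurePrepare_add hF.nonneg hF.le_one hΦ.posSemidef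
      (hΦ.one_sub.posSemidef.ofReal_smul (by positivity)) ?_
    rw [trace_maxEntangled hk0, htrace (trace_one_sub_maxEntangled hk0) (by field_simp)]
    simp
  · rw [partialTranspose_comp_distillation_comp hk]
    refine isOperation_measurePrepare_add (hF.neg_le_transpose.ofReal_smul (by positivity))
      (hF.transpose_le.ofReal_smul (by positivity)) (hS.posSemidef.ofReal_smul (by positivity))
      (hS.one_sub.posSemidef.ofReal_smul (by positivity)) ?_
    have h : ((k / 2 : ℝ) : ℂ) * ((1 / k : ℝ) : ℂ) = 1 / 2 := by
      rw [← Complex.ofReal_mul]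
      have : (k / 2 : ℝ) * (1 / k) = 1 / 2 := by field_simp
      rw [this]
      simp
    rw [htrace trace_symProjection (by field_simp),
      htrace trace_one_sub_symProjection (by
        rw [div_mul_div_cancel₀' two_ne_zero, div_self hsub.ne']),
      one_smul, one_smul, smul_add, smul_sub,
      smul_smul, h]
    module

theorem trace_maxEntangled_mul_distillation (hk : 0 < k) (F ρ : Matrix (a × b) (a × b) ℂ) :
    (maxEntangled k * distillation k F ρ).trace = (F * ρ).trace := by
  have hΦ := (isStarProjection_maxEntangled hk).isIdempotentElem
  simp [distillation, measurePrepare_apply, mul_add, hΦ.eq, hΦ.mul_one_sub_self,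
    trace_maxEntangled hk]

/-- For `k = 1` the target system is trivial, and the trace is a p.p.t. operation. -/
theorem trace_mem_pptFidelities_one (ρ : Matrix (a × b) (a × b) ℂ) :
    ρ.trace.re ∈ pptFidelities ρ 1 := by
  have hΦ : maxEntangled 1 = 1 := by
    ext p q
    rw [Subsingleton.elim p q, maxEntangled_apply]
    simp [Subsingleton.elim q.1 q.2]
  let Ψ : Matrix (a × b) (a × b) ℂ →ₗ[ℂ] Matrix (Fin 1 × Fin 1) (Fin 1 × Fin 1) ℂ :=
    measurePrepare 1 1 + measurePrepare 0 0
  have hΨ : IsOperation Ψ := isOperation_measurePrepare_add .one .zero .one .zero (by simp)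
  have hΨΓ : partialTranspose _ _ ∘ₗ Ψ ∘ₗ partialTranspose _ _ = Ψ := by
    simp only [Ψ, LinearMap.add_comp, LinearMap.comp_add,
      partialTranspose_comp_measurePrepare_comp, partialTranspose_one, map_zero]
  exact ⟨Ψ, ⟨hΨ, hΨΓ.symm ▸ hΨ⟩, by simp [Ψ, hΦ, measurePrepare_apply]⟩

/-- If the optimum over feasible operators is attained, then it is also the optimal fidelity of
p.p.t. distillation. -/
theorem isGreatest_pptFidelities (hk : 0 < k) {ρ : Matrix (a × b) (a × b) ℂ} (hρ : ρ.PosSemidef)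
    {v : ℝ} (hv : IsGreatest (primalValues ρ k) v) : IsGreatest (pptFidelities ρ k) v := by
  refine ⟨?_, fun w hw => hv.2 (pptFidelities_subset_primalValues hk ρ hw)⟩
  obtain ⟨F, hF, hFv⟩ := hv.1
  rcases (Nat.one_le_iff_ne_zero.mpr hk.ne').eq_or_lt with rfl | hk1
  · have h : v = ρ.trace.re := by
      refine le_antisymm ?_ (hv.2 (pptFidelities_subset_primalValues hk ρ
        (trace_mem_pptFidelities_one ρ)))
      have h0 := hF.le_one.trace_mul_re_nonneg hρ
      rw [sub_mul, one_mul, Matrix.trace_sub, Complex.sub_re] at h0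
      linarith
    exact h ▸ trace_mem_pptFidelities_one ρ
  · exact ⟨_, isPPTOperation_distillation hk1 hF, by
      rw [trace_maxEntangled_mul_distillation hk, hFv]⟩

end Distillation

/-! ### Attainment of the optimum -/

theorem zero_mem_primalValues {a b : Type*} [Fintype a] [Fintype b] [DecidableEq a] [DecidableEq b]
    (ρ : Matrix (a × b) (a × b) ℂ) {K : ℝ} (hK : 0 < K) : 0 ∈ primalValues ρ K := by
  have h : (((1 / K : ℝ) : ℂ) • (1 : Matrix (a × b) (a × b) ℂ)).PosSemidef :=
    Matrix.PosSemidef.one.ofReal_smul (by positivity)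
  refine ⟨0, ⟨Matrix.isHermitian_zero, .zero, ?_, ?_, ?_⟩, by simp⟩
  · rw [sub_zero]
    exact .one
  · rwa [map_zero, zero_add]
  · rwa [map_zero, sub_zero]

theorem posSemidef_isotropic {f : ℝ} {d : ℕ} (hf0 : 0 ≤ f) (hf1 : f ≤ 1) (hd : 1 < d) :
    (isotropic d f).PosSemidef := by
  have hΦ := isStarProjection_maxEntangled (by omega : 0 < d)
  have h : (1 : ℝ) < d := by exact_mod_cast hd
  have h' : (0 : ℝ) ≤ (d : ℝ) ^ 2 - 1 := by nlinarith
  exact (hΦ.posSemidef.ofReal_smul hf0).add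
    (hΦ.one_sub.posSemidef.ofReal_smul (div_nonneg (sub_nonneg.mpr hf1) h'))

end

theorem mainTheorem8 (f K : ℝ) (d n : ℕ) (hf0 : 0 ≤ f) (hf1 : f ≤ 1) (hK : 0 < K)
    (hd : 1 < d) (hn : 0 < n) :
    IsGreatest (lpValues d n f K) (FGamma (bipartitePower (isotropic d f) n) K) ∧
    IsGreatest (primalValues (bipartitePower (isotropic d f) n) K)
      (FGamma (bipartitePower (isotropic d f) n) K) ∧
    ∀ k : ℕ, (k : ℝ) = K →
      IsGreatest (pptFidelities (bipartitePower (isotropic d f) n) k)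
        (FGamma (bipartitePower (isotropic d f) n) K) := by
  have hlp := primalValues_eq_lpValues (n := n) f K hd
  have hprimal : IsGreatest (primalValues (bipartitePower (isotropic d f) n) K)
      (FGamma (bipartitePower (isotropic d f) n) K) := by
    refine IsCompact.isGreatest_sSup ?_ ⟨0, zero_mem_primalValues _ hK⟩
    rw [hlp]
    exact isCompact_lpValues f K
  refine ⟨hlp ▸ hprimal, hprimal, ?_⟩
  rintro k rfl
  exact isGreatest_pptFidelities (Nat.cast_pos.mp hK)
    (posSemidef_bipartiteProduct fun _ => posSemidef_isotropic hf0 hf1 hd) hprimal
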